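/- Let $\mathbb S^2\subset\mathbb R^3$ be the unit sphere with the round metric. For $\alpha\in\mathbb R$ consider, for a tangent vector field $v$ and scalar functions $f,p$ on $\mathbb S^2$, the reduced stationary homogeneous Euler system $$(2-\alpha)f+\operatorname{div}v=0,\qquad v\cdot\nabla f=|v|^2+\alpha f^2+2\alpha p,\qquad (1-\alpha)f\,v+\nabla_v v=-\nabla p,$$ where $\nabla$, $\operatorname{div}$ and $\nabla_v v$ are the gradient, divergence and Levi-Civita covariant derivative on $\mathbb S^2$ (this is the stationary Euler system on $\mathbb R^3\setminus\{0\}$ for the velocity field $V=(v+f\vec n)/|x|^{\alpha}$ and the pressure $P=p/|x|^{2\alpha}$, with $v,f,p$ evaluated at $x/|x|$ and $\vec n=x/|x|$). A $C^1$-solution is a triple $(v,f,p)$ of class $C^1$ on $\mathbb S^2$ that satisfies the three equations at every point. For $\alpha=1$ the only $C^1$-solution is the trivial one: a triple $(v,f,p)$ is a $C^1$-solution if and only if $v=0$, $f=0$ and $p=0$ on $\mathbb S^2$. -/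

import Mathlib

open scoped Manifold ContDiff RealInnerProductSpace

noncomputable section

namespace SphereEuler

/-- Euclidean three-space. -/
abbrev E3 : Type := EuclideanSpace ℝ (Fin 3)

/-- The unit sphere of Euclidean three-space. -/
abbrev S2 : Type := Metric.sphere (0 : E3) 1

instance factFinrank : Fact (Module.finrank ℝ E3 = 2 + 1) := ⟨by simp⟩

theorem normalize_mem (y : E3) (h : y ≠ 0) : ‖y‖⁻¹ • y ∈ Metric.sphere (0 : E3) 1 := by
  simp [norm_smul, h]

/-- The `0`-homogeneous extension `y ↦ g (y / |y|)` of a map `g` on the sphere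
(with the irrelevant value `0` at the origin). -/
def homExt {F : Type*} [Zero F] (g : S2 → F) (y : E3) : F :=
  open Classical in if h : y = 0 then 0 else g ⟨‖y‖⁻¹ • y, normalize_mem y h⟩

/-- The orthogonal projection of the ambient space onto the tangent plane of the sphere
at `x`, i.e. onto the orthogonal complement of the line through `x`. -/
def tangentProj (x : S2) : E3 →L[ℝ] E3 :=
  (ℝ ∙ (x : E3))ᗮ.starProjection

/-- The gradient on the sphere of a scalar function: the (ambient) gradient at `x` of the
`0`-homogeneous extension. It is tangent to the sphere, and represents the differential
of `f` for the round metric. -/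
def sphereGrad (f : S2 → ℝ) (x : S2) : E3 :=
  gradient (homExt f) (x : E3)

/-- The covariant derivative `w ↦ ∇_w v` at `x` of a tangent field `v`, for the Levi-Civita
connection of the round sphere: the tangential part of the ambient derivative of `v`. -/
def covDeriv (v : S2 → E3) (x : S2) : E3 →L[ℝ] E3 :=
  tangentProj x ∘L fderiv ℝ (homExt v) (x : E3)

/-- The divergence of a tangent field: the trace of its covariant derivative. (The covariant
derivative takes values in the tangent plane, so that its trace over the ambient space is the
trace of its restriction to the tangent plane.) -/
def sphereDiv (v : S2 → E3) (x : S2) : ℝ :=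
  LinearMap.trace ℝ E3 (covDeriv v x : E3 →ₗ[ℝ] E3)

/-- `(v, f, p)` is a `C¹` solution of the stationary `α`-homogeneous Euler system reduced to the
sphere: `v` is a tangent vector field, `f` the radial velocity, `p` the spherical pressure. -/
structure IsC1Solution (α : ℝ) (v : S2 → E3) (f p : S2 → ℝ) : Prop where
  tangent : ∀ x : S2, ⟪v x, (x : E3)⟫ = 0
  contMDiff_v : ContMDiff (𝓡 2) 𝓘(ℝ, E3) 1 v
  contMDiff_f : ContMDiff (𝓡 2) 𝓘(ℝ, ℝ) 1 f
  contMDiff_p : ContMDiff (𝓡 2) 𝓘(ℝ, ℝ) 1 p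
  /-- `(2 - α) f + div v = 0` -/
  incompressible : ∀ x : S2, (2 - α) * f x + sphereDiv v x = 0
  /-- `v ∇f = |v|² + α f² + 2 α p` -/
  radial : ∀ x : S2,
    ⟪v x, sphereGrad f x⟫ = ‖v x‖ ^ 2 + α * f x ^ 2 + 2 * α * p x
  /-- `(1 - α) f v + v ∇v = -∇p` -/
  tangential : ∀ x : S2,
    ((1 - α) * f x) • v x + covDeriv v x (v x) = -sphereGrad p x

end SphereEuler

end

open scoped Manifold ContDiff RealInnerProductSpace

noncomputable section

namespace SphereEuler

open MeasureTheory Filter Topology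

set_option maxSynthPendingDepth 3

/-! ### Integral identities for compactly supported `C¹` fields -/

section

section Integration

variable {G : Type*} [NormedAddCommGroup G] [NormedSpace ℝ G] [FiniteDimensional ℝ G]
  [MeasurableSpace G] [BorelSpace G] {μ : Measure G} [μ.IsAddHaarMeasure]

/-! Put `B = |v|² + 2p`. Pairing the tangential equation with `v` gives `v·∇B = 0`, and the other
two equations then give `div(B f v) = B²`. A divergence has zero integral, so `B = 0`. Now `v·∇f =
f²`, hence `div(f³ v) = 2f⁴` and `f = 0`.

What remains is `div v = 0` and `∇_v v = ½∇|v|²`. The latter says that `curl v` vanishes wherever `v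
≠ 0`, hence everywhere by continuity. Thus `v` is a harmonic field on a surface of positive
curvature, and Bochner's argument gives `v = 0`, then `p = 0`.

All integration takes place in three-space: `0`-homogeneous extensions are multiplied by a radial
cutoff (`div_eq_zero_of_nonneg`). Bochner's formula would need second derivatives, which a `C¹`
field lacks; it is replaced by the vanishing of `∫ tr((DW)²) - (tr DW)²` (`integral_trSq_fderiv`),
applied in `eq_zero_of_tangentDeriv_symm`. The argument is assembled in `homogeneous_rigidity`. -/

theorem integral_fderiv_apply_eq_zero {a : G → ℝ} (ha : ContDiff ℝ 1 a)
    (hac : HasCompactSupport a) (v : G) : ∫ x, fderiv ℝ a x v ∂μ = 0 := by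
  have hd : Continuous fun x => fderiv ℝ a x v :=
    (ha.continuous_fderiv one_ne_zero).clm_apply continuous_const
  have h := integral_mul_fderiv_eq_neg_fderiv_mul_of_integrable (μ := μ) (f := fun _ : G => (1 : ℝ))
    (g := a) (v := v) (by simp)
    (by simpa using hd.integrable_of_hasCompactSupport (hac.fderiv_apply ℝ v))
    (by simpa using ha.continuous.integrable_of_hasCompactSupport hac)
    (fun _ _ => differentiableAt_const _)
    (fun x _ => ha.differentiable one_ne_zero x)
  simpa using h

theorem convolution_zero_apply_apply {E E' : Type*} [NormedAddCommGroup E] [NormedSpace ℝ E]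
    [NormedAddCommGroup E'] [NormedSpace ℝ E'] (L : E →L[ℝ] E' →L[ℝ] G →L[ℝ] G →L[ℝ] ℝ)
    {A : G → E} {B : G → E'} (hA : Continuous A) (hAc : HasCompactSupport A) (hB : Continuous B)
    (v w : G) : (convolution A B L μ) 0 v w = ∫ t, L (A t) (B (-t)) v w ∂μ := by
  have hint : Integrable (fun t => L (A t) (B (0 - t))) μ :=
    hAc.convolutionExists_left L hA hB.locallyIntegrable 0
  rw [convolution_def, ContinuousLinearMap.integral_apply hint,
    ContinuousLinearMap.integral_apply (hint.apply_continuousLinearMap v)]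
  simp

/-- The convolution of two `C¹` functions is twice differentiable, one derivative falling on each
factor. Both sides are its mixed second derivative at `0`, which is symmetric. -/
theorem integral_fderiv_mul_fderiv_neg_comm {a b : G → ℝ} (ha : ContDiff ℝ 1 a)
    (hac : HasCompactSupport a) (hb : ContDiff ℝ 1 b) (hbc : HasCompactSupport b) (v w : G) :
    ∫ t, fderiv ℝ b t v * fderiv ℝ a (-t) w ∂μ = ∫ t, fderiv ℝ b t w * fderiv ℝ a (-t) v ∂μ := by
  have hda : Continuous (fderiv ℝ a) := ha.continuous_fderiv one_ne_zero
  have hdb : Continuous (fderiv ℝ b) := hb.continuous_fderiv one_ne_zero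
  have h1 : ∀ x, HasFDerivAt _ _ x := hac.hasFDerivAt_convolution_right (μ := μ)
    (ContinuousLinearMap.mul ℝ ℝ) hb.continuous.locallyIntegrable ha
  have h2 := hbc.hasFDerivAt_convolution_left (μ := μ)
    ((ContinuousLinearMap.mul ℝ ℝ).precompR G) hb hda.locallyIntegrable 0
  have key : ∀ v w, (convolution (𝕜 := ℝ) (F := G →L[ℝ] G →L[ℝ] ℝ) (fderiv ℝ b) (fderiv ℝ a)
      (((ContinuousLinearMap.mul ℝ ℝ).precompR G).precompL G) μ) 0 v w
      = ∫ t, fderiv ℝ b t v * fderiv ℝ a (-t) w ∂μ := by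
    intro v w
    exact convolution_zero_apply_apply _ hdb (hbc.fderiv ℝ) hda v w
  rw [← key, ← key]
  exact second_derivative_symmetric h1 h2 v w

/-- Partial derivatives of `C¹` functions can be exchanged under the integral. -/
theorem integral_fderiv_mul_fderiv_comm {a b : G → ℝ} (ha : ContDiff ℝ 1 a)
    (hac : HasCompactSupport a) (hb : ContDiff ℝ 1 b) (hbc : HasCompactSupport b) (v w : G) :
    ∫ t, fderiv ℝ b t v * fderiv ℝ a t w ∂μ = ∫ t, fderiv ℝ b t w * fderiv ℝ a t v ∂μ := by
  -- Reflecting `a` turns the convolution at `0` into a product evaluated at a single point.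
  have h := integral_fderiv_mul_fderiv_neg_comm (μ := μ) (a := fun x => a (-x))
    (ha.comp contDiff_neg) (hac.comp_homeomorph (Homeomorph.neg G)) hb hbc v w
  have hn : ∀ t u, fderiv ℝ (fun x => a (-x)) (-t) u = -fderiv ℝ a t u := by
    intro t u
    have h1 : HasFDerivAt a (fderiv ℝ a t) (- -t) := by
      rw [neg_neg]; exact (ha.differentiable one_ne_zero t).hasFDerivAt
    have h2 := h1.comp (-t) (hasFDerivAt_id (-t)).neg
    simpa [Function.comp_def] using congrArg (fun L => L u) h2.fderiv
  simpa [hn, integral_neg] using h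

end Integration

/-- The standard basis vectors. -/
def e (i : Fin 3) : E3 := EuclideanSpace.single i 1

/-- The trace of an endomorphism of Euclidean three-space, in the standard basis. -/
def tr (L : E3 →L[ℝ] E3) : ℝ := ∑ i, L (e i) i

/-- The trace of the square of an endomorphism of Euclidean three-space. -/
def trSq (L : E3 →L[ℝ] E3) : ℝ := ∑ i, ∑ j, L (e i) j * L (e j) i

variable {W U : E3 → E3}

theorem contDiff_coord (hW : ContDiff ℝ 1 W) (i : Fin 3) : ContDiff ℝ 1 fun y => W y i :=
  (EuclideanSpace.proj (𝕜 := ℝ) i).contDiff.comp hW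

theorem hasCompactSupport_coord (hc : HasCompactSupport W) (i : Fin 3) :
    HasCompactSupport fun y => W y i :=
  hc.comp_left (g := fun x : E3 => x i) rfl

theorem fderiv_coord (hW : ContDiff ℝ 1 W) (i : Fin 3) (y h : E3) :
    fderiv ℝ (fun y => W y i) y h = fderiv ℝ W y h i := by
  have := ((EuclideanSpace.proj (𝕜 := ℝ) i).hasFDerivAt.comp y
    (hW.differentiable one_ne_zero y).hasFDerivAt).fderiv
  exact congrArg (fun L => L h) this

theorem continuous_fderiv_coord (hW : ContDiff ℝ 1 W) (h : E3) (i : Fin 3) :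
    Continuous fun y => fderiv ℝ W y h i :=
  (EuclideanSpace.proj (𝕜 := ℝ) i).continuous.comp
    ((hW.continuous_fderiv one_ne_zero).clm_apply continuous_const)

theorem hasCompactSupport_fderiv_coord (hc : HasCompactSupport W) (h : E3) (i : Fin 3) :
    HasCompactSupport fun y => fderiv ℝ W y h i :=
  (hc.fderiv_apply ℝ h).comp_left (g := fun x : E3 => x i) rfl

theorem integrable_fderiv_coord (hW : ContDiff ℝ 1 W) (hc : HasCompactSupport W) (h : E3)
    (i : Fin 3) : Integrable fun y => fderiv ℝ W y h i :=
  (continuous_fderiv_coord hW h i).integrable_of_hasCompactSupport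
    (hasCompactSupport_fderiv_coord hc h i)

theorem integrable_fderiv_coord_mul (hW : ContDiff ℝ 1 W) (hc : HasCompactSupport W) (h k : E3)
    (i j : Fin 3) : Integrable fun y => fderiv ℝ W y h i * fderiv ℝ W y k j :=
  ((continuous_fderiv_coord hW h i).mul
    (continuous_fderiv_coord hW k j)).integrable_of_hasCompactSupport
    (hasCompactSupport_fderiv_coord hc h i).mul_right

theorem integral_tr_fderiv (hW : ContDiff ℝ 1 W) (hc : HasCompactSupport W) :
    ∫ y, tr (fderiv ℝ W y) = 0 := by
  unfold tr
  rw [integral_finsetSum _ fun i _ => integrable_fderiv_coord hW hc (e i) i]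
  refine Finset.sum_eq_zero fun i _ => ?_
  simp_rw [← fderiv_coord hW]
  exact integral_fderiv_apply_eq_zero (contDiff_coord hW i) (hasCompactSupport_coord hc i) _

/-- The integrand is a sum of `2 × 2` minors of the Jacobian matrix, up to sign; each is a null
Lagrangian, since exchanging partial derivatives makes its two products integrate to the same value.
-/
theorem integral_trSq_fderiv (hW : ContDiff ℝ 1 W) (hc : HasCompactSupport W) :
    ∫ y, (trSq (fderiv ℝ W y) - tr (fderiv ℝ W y) ^ 2) = 0 := by
  have h : ∀ y, trSq (fderiv ℝ W y) - tr (fderiv ℝ W y) ^ 2 =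
      ∑ i, ∑ j, (fderiv ℝ W y (e i) j * fderiv ℝ W y (e j) i -
        fderiv ℝ W y (e i) i * fderiv ℝ W y (e j) j) := by
    intro y
    simp only [trSq, tr, sq, Finset.sum_mul_sum, Finset.sum_sub_distrib]
  simp_rw [h]
  have hI := integrable_fderiv_coord_mul hW hc
  have hS : ∀ i j, Integrable fun y => fderiv ℝ W y (e i) j * fderiv ℝ W y (e j) i -
      fderiv ℝ W y (e i) i * fderiv ℝ W y (e j) j := fun i j => (hI _ _ _ _).sub (hI _ _ _ _)
  rw [integral_finsetSum _ fun i _ => integrable_finsetSum _ fun j _ => hS i j]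
  refine Finset.sum_eq_zero fun i _ => ?_
  rw [integral_finsetSum _ fun j _ => hS i j]
  refine Finset.sum_eq_zero fun j _ => ?_
  rw [integral_sub (hI _ _ _ _) (hI _ _ _ _), sub_eq_zero]
  simp_rw [← fderiv_coord hW]
  have := integral_fderiv_mul_fderiv_comm (μ := volume) (contDiff_coord hW i)
    (hasCompactSupport_coord hc i) (contDiff_coord hW j) (hasCompactSupport_coord hc j) (e i) (e j)
  rw [this]
  simp_rw [mul_comm]

theorem continuous_tr_fderiv (hW : ContDiff ℝ 1 W) : Continuous fun y => tr (fderiv ℝ W y) :=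
  continuous_finsetSum _ fun _ _ => continuous_fderiv_coord hW _ _

theorem hasCompactSupport_tr_fderiv (hc : HasCompactSupport W) :
    HasCompactSupport fun y => tr (fderiv ℝ W y) :=
  (hc.fderiv ℝ).comp_left (g := tr) (by simp [tr])

theorem eq_zero_of_integral_eq_zero {g : E3 → ℝ} (hg : Continuous g) (hc : HasCompactSupport g)
    (h0 : ∀ y, 0 ≤ g y) (hi : ∫ y, g y = 0) (y : E3) : g y = 0 := by
  by_contra hy
  exact (hg.integral_pos_of_hasCompactSupport_nonneg_nonzero hc h0 hy).ne' hi

/-- A compactly supported `C¹` field with nonnegative divergence has zero divergence. -/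
theorem tr_fderiv_eq_zero (hW : ContDiff ℝ 1 W) (hc : HasCompactSupport W)
    (h0 : ∀ y, 0 ≤ tr (fderiv ℝ W y)) (y : E3) : tr (fderiv ℝ W y) = 0 :=
  eq_zero_of_integral_eq_zero (continuous_tr_fderiv hW) (hasCompactSupport_tr_fderiv hc) h0
    (integral_tr_fderiv hW hc) y

theorem continuous_trSq_sub (hW : ContDiff ℝ 1 W) :
    Continuous fun y => trSq (fderiv ℝ W y) - tr (fderiv ℝ W y) ^ 2 := by
  have h1 : Continuous fun y => trSq (fderiv ℝ W y) :=
    continuous_finsetSum _ fun _ _ => continuous_finsetSum _ fun _ _ =>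
      (continuous_fderiv_coord hW _ _).mul (continuous_fderiv_coord hW _ _)
  exact h1.sub ((continuous_tr_fderiv hW).pow 2)

theorem hasCompactSupport_trSq_sub (hc : HasCompactSupport W) :
    HasCompactSupport fun y => trSq (fderiv ℝ W y) - tr (fderiv ℝ W y) ^ 2 :=
  (hc.fderiv ℝ).comp_left (g := fun L => trSq L - tr L ^ 2) (by simp [tr, trSq])

theorem add_eq_zero_of_integral_eq_zero {S T : E3 → ℝ} (hS : Continuous S)
    (hSc : HasCompactSupport S) (hSi : ∫ y, S y = 0) (hT : Continuous T)
    (hTc : HasCompactSupport T) (hTi : ∫ y, T y = 0) (h0 : ∀ y, 0 ≤ S y + T y) (y : E3) :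
    S y + T y = 0 :=
  eq_zero_of_integral_eq_zero (g := fun y => S y + T y) (hS.add hT) (hSc.add hTc) h0
    (by rw [integral_add (hS.integrable_of_hasCompactSupport hSc)
          (hT.integrable_of_hasCompactSupport hTc), hSi, hTi, add_zero]) y

theorem trSq_fderiv_add_eq_zero (hW : ContDiff ℝ 1 W) (hc : HasCompactSupport W)
    (hU : ContDiff ℝ 1 U) (hUc : HasCompactSupport U)
    (h0 : ∀ y, 0 ≤ (trSq (fderiv ℝ W y) - tr (fderiv ℝ W y) ^ 2) + tr (fderiv ℝ U y)) (y : E3) :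
    (trSq (fderiv ℝ W y) - tr (fderiv ℝ W y) ^ 2) + tr (fderiv ℝ U y) = 0 :=
  add_eq_zero_of_integral_eq_zero (continuous_trSq_sub hW) (hasCompactSupport_trSq_sub hc)
    (integral_trSq_fderiv hW hc) (continuous_tr_fderiv hU) (hasCompactSupport_tr_fderiv hUc)
    (integral_tr_fderiv hU hUc) h0 y

end

/-! ### Trace algebra, alternating forms and the radial cutoff -/

section

theorem eq_sum_smul_e (x : E3) : x = ∑ i, x i • e i := by
  ext j
  fin_cases j <;> simp [e, Fin.sum_univ_three]

theorem map_eq_sum {F : Type*} [NormedAddCommGroup F] [NormedSpace ℝ F] (L : E3 →L[ℝ] F) (x : E3) :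
    L x = ∑ i, x i • L (e i) := by
  conv_lhs => rw [eq_sum_smul_e x]
  simp

theorem tr_add (L M : E3 →L[ℝ] E3) : tr (L + M) = tr L + tr M := by
  simp [tr, Finset.sum_add_distrib]

theorem tr_smul (c : ℝ) (L : E3 →L[ℝ] E3) : tr (c • L) = c * tr L := by
  simp [tr, Finset.mul_sum]

theorem tr_smulRight (l : E3 →L[ℝ] ℝ) (x : E3) : tr (l.smulRight x) = l x := by
  rw [map_eq_sum l x]
  simp [tr, mul_comm]

theorem tr_id : tr (ContinuousLinearMap.id ℝ E3) = 3 := by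
  simp [tr, e]

/-- Serves both the derivative of a cut-off field and the comparison of `tangentDeriv` with the
ambient derivative: each is a rank-one perturbation. -/
theorem trSq_smul_add_smulRight (c : ℝ) (L : E3 →L[ℝ] E3) (l : E3 →L[ℝ] ℝ) (x : E3) :
    trSq (c • L + l.smulRight x) = c ^ 2 * trSq L + 2 * c * l (L x) + l x ^ 2 := by
  rw [map_eq_sum l (L x), map_eq_sum l x, map_eq_sum L x]
  simp only [trSq, Fin.sum_univ_three, add_apply,
    smul_apply, ContinuousLinearMap.smulRight_apply, PiLp.add_apply,
    PiLp.smul_apply, smul_eq_mul]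
  ring

theorem inner_eq (x y : E3) : ⟪x, y⟫ = x 0 * y 0 + x 1 * y 1 + x 2 * y 2 := by
  simp [PiLp.inner_apply, Fin.sum_univ_three, mul_comm]

theorem inner_e (x : E3) (i : Fin 3) : ⟪x, e i⟫ = x i := by
  fin_cases i <;> simp [inner_eq, e]

theorem trSq_nonneg_of_symm {L : E3 →L[ℝ] E3} (h : ∀ x y, ⟪L x, y⟫ = ⟪L y, x⟫) : 0 ≤ trSq L := by
  refine Finset.sum_nonneg fun i _ => Finset.sum_nonneg fun j _ => ?_
  have := h (e i) (e j)
  rw [inner_e, inner_e] at this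
  rw [this]
  exact mul_self_nonneg _

/-- Here `p, q, s` are the entries above the diagonal of an antisymmetric matrix that kills `y` and
`u`. A nonzero such matrix has a one-dimensional kernel, whereas `hc` says that `y × u ≠ 0`. Each
certificate multiplies an entry by `|y × u|²`. -/
theorem eq_zero_of_cross_eq_zero {p q s y₀ y₁ y₂ u₀ u₁ u₂ : ℝ}
    (hc : (y₁ * u₂ - y₂ * u₁) ^ 2 + (y₂ * u₀ - y₀ * u₂) ^ 2 + (y₀ * u₁ - y₁ * u₀) ^ 2 ≠ 0)
    (ay : y₁ * p + y₂ * q = 0) (hy : y₀ * p - y₂ * s = 0) (cy : y₀ * q + y₁ * s = 0)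
    (au : u₁ * p + u₂ * q = 0) (bu : u₀ * p - u₂ * s = 0) (cu : u₀ * q + u₁ * s = 0) :
    p = 0 ∧ q = 0 ∧ s = 0 := by
  refine ⟨(mul_eq_zero.1 ?_).resolve_right hc, (mul_eq_zero.1 ?_).resolve_right hc,
    (mul_eq_zero.1 ?_).resolve_right hc⟩
  · linear_combination (y₁ * u₂ - y₂ * u₁) * (u₂ * ay - y₂ * au) +
      (y₂ * u₀ - y₀ * u₂) * (y₂ * bu - u₂ * hy) +
      (y₀ * u₁ - y₁ * u₀) * (u₁ * hy - u₀ * ay + y₂ * cu)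
  · linear_combination (y₁ * u₂ - y₂ * u₁) * (y₁ * au - u₁ * ay) +
      (y₂ * u₀ - y₀ * u₂) * (u₀ * ay - y₁ * bu - u₂ * cy) +
      (y₀ * u₁ - y₁ * u₀) * (u₁ * cy - y₁ * cu)
  · linear_combination (y₁ * u₂ - y₂ * u₁) * (u₂ * cy + u₁ * hy - y₀ * au) +
      (y₂ * u₀ - y₀ * u₂) * (y₀ * bu - u₀ * hy) +
      (y₀ * u₁ - y₁ * u₀) * (y₀ * cu - u₀ * cy)

/-- An alternating bilinear form on three-space whose kernel contains two orthogonal nonzero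
vectors vanishes. -/
theorem symm_of_kernel {N : E3 →L[ℝ] E3} {y u : E3} (hy : y ≠ 0) (hu : u ≠ 0) (hyu : ⟪u, y⟫ = 0)
    (h1 : ∀ h, ⟪N y, h⟫ = ⟪N h, y⟫) (h2 : ∀ h, ⟪N u, h⟫ = ⟪N h, u⟫) (h k : E3) :
    ⟪N h, k⟫ = ⟪N k, h⟫ := by
  have hc : (y 1 * u 2 - y 2 * u 1) ^ 2 + (y 2 * u 0 - y 0 * u 2) ^ 2 +
      (y 0 * u 1 - y 1 * u 0) ^ 2 ≠ 0 := by
    have e1 : 0 < ⟪y, y⟫ := real_inner_self_pos.2 hy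
    have e2 : 0 < ⟪u, u⟫ := real_inner_self_pos.2 hu
    rw [inner_eq] at e1 e2 hyu
    have e3 := mul_pos e1 e2
    -- Lagrange's identity for `|y × u|²`.
    have : (y 1 * u 2 - y 2 * u 1) ^ 2 + (y 2 * u 0 - y 0 * u 2) ^ 2 +
      (y 0 * u 1 - y 1 * u 0) ^ 2 = (y 0 * y 0 + y 1 * y 1 + y 2 * y 2) *
        (u 0 * u 0 + u 1 * u 1 + u 2 * u 2) - (u 0 * y 0 + u 1 * y 1 + u 2 * y 2) ^ 2 := by ring
    rw [this, hyu]
    nlinarith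
  have a0 := h1 (e 0)
  have a1 := h1 (e 1)
  have a2 := h1 (e 2)
  have b0 := h2 (e 0)
  have b1 := h2 (e 1)
  have b2 := h2 (e 2)
  simp only [inner_e] at a0 a1 a2 b0 b1 b2
  rw [map_eq_sum N y] at a0 a1 a2
  rw [map_eq_sum N u] at b0 b1 b2
  simp only [inner_eq, Fin.sum_univ_three, PiLp.add_apply, PiLp.smul_apply, smul_eq_mul]
    at a0 a1 a2 b0 b1 b2
  obtain ⟨p0, q0, s0⟩ := eq_zero_of_cross_eq_zero (p := N (e 0) 1 - N (e 1) 0)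
    (q := N (e 0) 2 - N (e 2) 0) (s := N (e 1) 2 - N (e 2) 1) hc
    (by linear_combination -a0) (by linear_combination a1) (by linear_combination a2)
    (by linear_combination -b0) (by linear_combination b1) (by linear_combination b2)
  rw [map_eq_sum N h, map_eq_sum N k]
  simp only [inner_eq, Fin.sum_univ_three, PiLp.add_apply, PiLp.smul_apply, smul_eq_mul]
  linear_combination (h 0 * k 1 - h 1 * k 0) * p0 + (h 0 * k 2 - h 2 * k 0) * q0 +
    (h 1 * k 2 - h 2 * k 1) * s0

/-- A smooth bump function on the line, centred at `1` and vanishing near `0`. -/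
def bump : ContDiffBump (1 : ℝ) := ⟨1 / 4, 1 / 2, by norm_num, by norm_num⟩

/-- A radial smooth cutoff, equal to `1` on the unit sphere and supported in an annulus. -/
def cutoff (y : E3) : ℝ := bump (‖y‖ ^ 2)

/-- The radial factor in the derivative of the cutoff. -/
def cutoffDeriv (y : E3) : ℝ := 2 * deriv bump (‖y‖ ^ 2)

theorem contDiff_cutoff : ContDiff ℝ 1 cutoff :=
  bump.contDiff.comp (contDiff_norm_sq ℝ)

theorem cutoff_nonneg (y : E3) : 0 ≤ cutoff y := bump.nonneg

theorem cutoff_eq_one {y : E3} (hy : ‖y‖ = 1) : cutoff y = 1 :=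
  bump.one_of_mem_closedBall (by simp [hy, bump])

theorem cutoff_eventuallyEq_zero : ∀ᶠ y in 𝓝 (0 : E3), cutoff y = 0 := by
  have : ∀ᶠ y in 𝓝 (0 : E3), ‖y‖ ^ 2 < 1 / 2 :=
    (continuous_norm.pow 2).continuousAt.eventually_lt continuousAt_const (by simp)
  filter_upwards [this] with y hy
  refine bump.zero_of_le_dist ?_
  rw [Real.dist_eq, abs_of_nonpos (by linarith)]
  simp only [bump]
  linarith

theorem hasCompactSupport_cutoff : HasCompactSupport cutoff := by
  refine HasCompactSupport.intro (isCompact_closedBall (0 : E3) 2) fun y hy => ?_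
  have hy' : 2 < ‖y‖ := by simpa using hy
  refine bump.zero_of_le_dist ?_
  rw [Real.dist_eq, abs_of_nonneg (by nlinarith)]
  simp only [bump]
  nlinarith

theorem hasFDerivAt_cutoff (y : E3) : HasFDerivAt cutoff (cutoffDeriv y • innerSL ℝ y) y := by
  have h1 : HasFDerivAt (fun y : E3 => ‖y‖ ^ 2) (2 • innerSL ℝ y) y :=
    (hasStrictFDerivAt_norm_sq y).hasFDerivAt
  have h2 : HasDerivAt bump (deriv bump (‖y‖ ^ 2)) (‖y‖ ^ 2) :=
    ((bump.contDiff (n := 1)).differentiable one_ne_zero _).hasDerivAt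
  refine (h2.comp_hasFDerivAt y h1).congr_fderiv ?_
  ext h
  simp [cutoffDeriv]
  ring

variable {g : E3 → ℝ} {u : E3 → E3}

theorem cutoff_mul_smul_eventuallyEq_zero :
    (fun y => (cutoff y * g y) • u y) =ᶠ[𝓝 0] fun _ => 0 := by
  filter_upwards [cutoff_eventuallyEq_zero] with y hy
  simp [hy]

theorem contDiff_cutoff_mul_smul (hg : ∀ y ≠ 0, ContDiffAt ℝ 1 g y)
    (hu : ∀ y ≠ 0, ContDiffAt ℝ 1 u y) : ContDiff ℝ 1 fun y => (cutoff y * g y) • u y := by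
  rw [contDiff_iff_contDiffAt]
  intro y
  by_cases hy : y = 0
  · subst hy
    exact contDiffAt_const.congr_of_eventuallyEq cutoff_mul_smul_eventuallyEq_zero
  · exact (contDiff_cutoff.contDiffAt.mul (hg y hy)).smul (hu y hy)

theorem hasCompactSupport_cutoff_mul_smul :
    HasCompactSupport fun y => (cutoff y * g y) • u y :=
  HasCompactSupport.smul_right (f := fun y => cutoff y * g y) hasCompactSupport_cutoff.mul_right

theorem fderiv_cutoff_mul_smul_zero : fderiv ℝ (fun y => (cutoff y * g y) • u y) 0 = 0 := by
  rw [cutoff_mul_smul_eventuallyEq_zero.fderiv_eq]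
  simp

theorem fderiv_cutoff_mul_smul {y : E3} {g' : E3 →L[ℝ] ℝ} {D : E3 →L[ℝ] E3}
    (hg : HasFDerivAt g g' y) (hu : HasFDerivAt u D y) :
    fderiv ℝ (fun y => (cutoff y * g y) • u y) y = (cutoff y * g y) • D +
      (cutoff y • g' + (g y * cutoffDeriv y) • innerSL ℝ y).smulRight (u y) := by
  refine (((hasFDerivAt_cutoff y).mul hg).smul hu).fderiv.trans ?_
  congr 2
  rw [smul_smul]

theorem tr_fderiv_cutoff_mul_smul {y : E3} {g' : E3 →L[ℝ] ℝ} {D : E3 →L[ℝ] E3}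
    (hg : HasFDerivAt g g' y) (hu : HasFDerivAt u D y) :
    tr (fderiv ℝ (fun y => (cutoff y * g y) • u y) y) =
      cutoff y * (g y * tr D + g' (u y)) + g y * cutoffDeriv y * ⟪y, u y⟫ := by
  rw [fderiv_cutoff_mul_smul hg hu, tr_add, tr_smul, tr_smulRight]
  simp
  ring

/-- If the divergence of the `g`-multiple of a tangential field is nonnegative, it vanishes on
the unit sphere. -/
theorem div_eq_zero_of_nonneg (hg : ∀ y ≠ 0, ContDiffAt ℝ 1 g y)
    (hu : ∀ y ≠ 0, ContDiffAt ℝ 1 u y) (hyu : ∀ y ≠ 0, ⟪u y, y⟫ = 0)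
    (h0 : ∀ y ≠ 0, 0 ≤ g y * tr (fderiv ℝ u y) + fderiv ℝ g y (u y)) {y : E3} (hy : ‖y‖ = 1) :
    g y * tr (fderiv ℝ u y) + fderiv ℝ g y (u y) = 0 := by
  -- The gradient of the cutoff is radial and `u` is tangential, so differentiating the cutoff
  -- contributes nothing.
  have key : ∀ y ≠ 0, tr (fderiv ℝ (fun y => (cutoff y * g y) • u y) y) =
      cutoff y * (g y * tr (fderiv ℝ u y) + fderiv ℝ g y (u y)) := by
    intro y hy
    rw [tr_fderiv_cutoff_mul_smul ((hg y hy).differentiableAt one_ne_zero).hasFDerivAt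
      ((hu y hy).differentiableAt one_ne_zero).hasFDerivAt, real_inner_comm, hyu y hy]
    ring
  have hy0 : y ≠ 0 := by rintro rfl; simp at hy
  have h := tr_fderiv_eq_zero (contDiff_cutoff_mul_smul hg hu) hasCompactSupport_cutoff_mul_smul
    (fun z => ?_) y
  · rwa [key y hy0, cutoff_eq_one hy, one_mul] at h
  · by_cases hz : z = 0
    · subst hz
      simp [fderiv_cutoff_mul_smul_zero, tr]
    · rw [key z hz]
      exact mul_nonneg (cutoff_nonneg z) (h0 z hz)

end

/-! ### Rigidity of `0`-homogeneous tangential fields -/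

section

variable {u : E3 → E3}

theorem hasFDerivAt_of_contDiffAt {F : Type*} [NormedAddCommGroup F] [NormedSpace ℝ F] {g : E3 → F}
    {y : E3} (hg : ContDiffAt ℝ 1 g y) : HasFDerivAt g (fderiv ℝ g y) y :=
  (hg.differentiableAt one_ne_zero).hasFDerivAt

theorem inner_fderiv_radial (hu : ∀ y ≠ 0, ContDiffAt ℝ 1 u y) (hyu : ∀ y ≠ 0, ⟪u y, y⟫ = 0)
    {y : E3} (hy : y ≠ 0) (h : E3) : ⟪fderiv ℝ u y h, y⟫ = -⟪u y, h⟫ := by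
  have h1 := (hasFDerivAt_of_contDiffAt (hu y hy)).inner ℝ (hasFDerivAt_id y)
  have h2 : (fun z => ⟪u z, id z⟫) =ᶠ[𝓝 y] fun _ => 0 := by
    filter_upwards [isOpen_ne.mem_nhds hy] with z hz using hyu z hz
  have h3 := congrArg (fun L => L h) (h1.unique ((hasFDerivAt_const 0 y).congr_of_eventuallyEq h2))
  simp at h3
  linarith

/-- The covariant derivative of a tangential `0`-homogeneous field. -/
def tangentDeriv (u : E3 → E3) (y : E3) : E3 →L[ℝ] E3 :=
  fderiv ℝ u y + ((‖y‖ ^ 2)⁻¹ • innerSL ℝ (u y)).smulRight y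

theorem tangentDeriv_apply (u : E3 → E3) (y h : E3) :
    tangentDeriv u y h = fderiv ℝ u y h + ((‖y‖ ^ 2)⁻¹ * ⟪u y, h⟫) • y := by
  simp [tangentDeriv]

theorem continuousAt_tangentDeriv {y : E3} (hu : ContDiffAt ℝ 1 u y) (hy : y ≠ 0) (h : E3) :
    ContinuousAt (fun z => tangentDeriv u z h) y := by
  simp only [tangentDeriv_apply]
  have h1 : ContinuousAt (fderiv ℝ u) y := (hu.fderiv_right (m := 0) (by simp)).continuousAt
  have h2 : ContinuousAt (fun z : E3 => (‖z‖ ^ 2)⁻¹) y :=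
    (continuousAt_id.norm.pow 2).inv₀ (by simpa using hy)
  have h3 : ContinuousAt (fun z => ⟪u z, h⟫) y := hu.continuousAt.inner continuousAt_const
  exact (h1.clm_apply continuousAt_const).add ((h2.mul h3).smul continuousAt_id)

/-- The antisymmetric part of `tangentDeriv u y` has `y` in its kernel by tangency and homogeneity,
and `u y` by `hsym`, which is `∇_u u = ½∇|u|²`. These two vectors are orthogonal and nonzero. -/
theorem tangentDeriv_symm_of_ne_zero (hu : ∀ y ≠ 0, ContDiffAt ℝ 1 u y)
    (hyu : ∀ y ≠ 0, ⟪u y, y⟫ = 0) (hrad : ∀ y ≠ 0, fderiv ℝ u y y = 0)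
    (hsym : ∀ y ≠ 0, ∀ h, ⟪fderiv ℝ u y (u y), h⟫ + (‖y‖ ^ 2)⁻¹ * ‖u y‖ ^ 2 * ⟪y, h⟫ =
      ⟪fderiv ℝ u y h, u y⟫) {y : E3} (hy : y ≠ 0) (huy : u y ≠ 0) (h k : E3) :
    ⟪tangentDeriv u y h, k⟫ = ⟪tangentDeriv u y k, h⟫ := by
  have hn : ‖y‖ ^ 2 ≠ 0 := by simpa using hy
  refine symm_of_kernel hy huy (hyu y hy) (fun h => ?_) (fun h => ?_) h k
  · simp only [tangentDeriv_apply, hrad y hy, hyu y hy, inner_add_left, real_inner_smul_left,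
      inner_fderiv_radial hu hyu hy h, real_inner_self_eq_norm_sq, inner_zero_left]
    field_simp
    ring
  · simp only [tangentDeriv_apply, inner_add_left, real_inner_smul_left, ← hsym y hy h,
      real_inner_self_eq_norm_sq]
    rw [real_inner_comm (u y) y, hyu y hy]
    ring

theorem tangentDeriv_symm (hu : ∀ y ≠ 0, ContDiffAt ℝ 1 u y)
    (hyu : ∀ y ≠ 0, ⟪u y, y⟫ = 0) (hrad : ∀ y ≠ 0, fderiv ℝ u y y = 0)
    (hsym : ∀ y ≠ 0, ∀ h, ⟪fderiv ℝ u y (u y), h⟫ + (‖y‖ ^ 2)⁻¹ * ‖u y‖ ^ 2 * ⟪y, h⟫ =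
      ⟪fderiv ℝ u y h, u y⟫) {y : E3} (hy : y ≠ 0) (h k : E3) :
    ⟪tangentDeriv u y h, k⟫ = ⟪tangentDeriv u y k, h⟫ := by
  by_contra hne
  have hc : ∀ h, ContinuousAt (fun z => tangentDeriv u z h) y :=
    continuousAt_tangentDeriv (hu y hy) hy
  have h1 := (((hc h).inner (𝕜 := ℝ) (continuousAt_const (y := k))).sub
    ((hc k).inner (𝕜 := ℝ) (continuousAt_const (y := h)))).eventually_ne (sub_ne_zero.2 hne)
  -- A failure of symmetry would persist nearby by continuity, forcing `u` to vanish on a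
  -- neighbourhood; but there `tangentDeriv u` is zero, hence symmetric.
  have h2 : u =ᶠ[𝓝 y] fun _ => 0 := by
    filter_upwards [isOpen_ne.mem_nhds hy, h1] with z hz hz'
    by_contra huz
    exact hz' (sub_eq_zero.2 <| tangentDeriv_symm_of_ne_zero hu hyu hrad hsym hz huz h k)
  apply hne
  simp [tangentDeriv_apply, h2.fderiv_eq, h2.self_of_nhds]

theorem trSq_fderiv_nonneg (hu : ∀ y ≠ 0, ContDiffAt ℝ 1 u y)
    (hyu : ∀ y ≠ 0, ⟪u y, y⟫ = 0) (hrad : ∀ y ≠ 0, fderiv ℝ u y y = 0)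
    (hsym : ∀ y ≠ 0, ∀ h, ⟪fderiv ℝ u y (u y), h⟫ + (‖y‖ ^ 2)⁻¹ * ‖u y‖ ^ 2 * ⟪y, h⟫ =
      ⟪fderiv ℝ u y h, u y⟫) {y : E3} (hy : y ≠ 0) : 0 ≤ trSq (fderiv ℝ u y) := by
  have h := trSq_nonneg_of_symm (tangentDeriv_symm hu hyu hrad hsym hy)
  -- The normal correction leaves `trSq` unchanged, because `fderiv ℝ u y y = 0` and `⟪u y, y⟫ = 0`.
  have h1 := trSq_smul_add_smulRight 1 (fderiv ℝ u y) ((‖y‖ ^ 2)⁻¹ • innerSL ℝ (u y)) y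
  rw [one_smul, ← tangentDeriv, hrad y hy] at h1
  simp [hyu y hy] at h1
  rwa [h1] at h

/-- The divergence of the radial field `cutoff² |u|² y / |y|²`. -/
theorem tr_fderiv_radial (hu : ∀ y ≠ 0, ContDiffAt ℝ 1 u y)
    (hrad : ∀ y ≠ 0, fderiv ℝ u y y = 0) {y : E3} (hy : y ≠ 0) :
    tr (fderiv ℝ (fun z => (cutoff z * (cutoff z * ‖u z‖ ^ 2 * (‖z‖ ^ 2)⁻¹)) • z) y) =
      cutoff y ^ 2 * ‖u y‖ ^ 2 * (‖y‖ ^ 2)⁻¹ + 2 * cutoff y * cutoffDeriv y * ‖u y‖ ^ 2 := by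
  have hn : ‖y‖ ^ 2 ≠ 0 := by simpa using hy
  have h1 := (hasFDerivAt_of_contDiffAt (hu y hy)).norm_sq
  have h2 : HasFDerivAt (fun y : E3 => ‖y‖ ^ 2) (2 • innerSL ℝ y) y :=
    (hasStrictFDerivAt_norm_sq y).hasFDerivAt
  have h3 := (hasDerivAt_inv hn).comp_hasFDerivAt y h2
  have h4 := ((hasFDerivAt_cutoff y).mul h1).mul h3
  refine (tr_fderiv_cutoff_mul_smul h4 (hasFDerivAt_id y)).trans ?_
  simp [tr_id, hrad y hy]
  field_simp
  ring

theorem eq_zero_of_tangentDeriv_symm (hu : ∀ y ≠ 0, ContDiffAt ℝ 1 u y)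
    (hyu : ∀ y ≠ 0, ⟪u y, y⟫ = 0) (hrad : ∀ y ≠ 0, fderiv ℝ u y y = 0)
    (hdiv : ∀ y ≠ 0, tr (fderiv ℝ u y) = 0)
    (hsym : ∀ y ≠ 0, ∀ h, ⟪fderiv ℝ u y (u y), h⟫ + (‖y‖ ^ 2)⁻¹ * ‖u y‖ ^ 2 * ⟪y, h⟫ =
      ⟪fderiv ℝ u y h, u y⟫) {y : E3} (hy : ‖y‖ = 1) : u y = 0 := by
  have h1 : ∀ y : E3, y ≠ 0 → ContDiffAt ℝ 1 (fun _ : E3 => (1 : ℝ)) y :=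
    fun _ _ => contDiffAt_const
  have h2 : ∀ y : E3, y ≠ 0 →
      ContDiffAt ℝ 1 (fun z => cutoff z * ‖u z‖ ^ 2 * (‖z‖ ^ 2)⁻¹) y := fun y hy =>
    (contDiff_cutoff.contDiffAt.mul ((hu y hy).norm_sq ℝ)).mul
      ((contDiffAt_id.norm_sq ℝ).inv (by simpa using hy))
  have h3 : ∀ y : E3, y ≠ 0 → ContDiffAt ℝ 1 (fun z : E3 => z) y := fun _ _ => contDiffAt_id
  -- The radial field is chosen so that its `cutoffDeriv` term cancels the cross term of `trSq`,
  -- where `⟪y, Du u⟫ = -|u|²`. Its other term is the positive curvature term of Bochner's formula.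
  have key : ∀ y ≠ 0, (trSq (fderiv ℝ (fun y => (cutoff y * 1) • u y) y) -
      tr (fderiv ℝ (fun y => (cutoff y * 1) • u y) y) ^ 2) +
      tr (fderiv ℝ (fun z => (cutoff z * (cutoff z * ‖u z‖ ^ 2 * (‖z‖ ^ 2)⁻¹)) • z) y) =
      cutoff y ^ 2 * (trSq (fderiv ℝ u y) + ‖u y‖ ^ 2 * (‖y‖ ^ 2)⁻¹) := by
    intro y hy
    have hD := hasFDerivAt_of_contDiffAt (hu y hy)
    have hc : HasFDerivAt (fun _ : E3 => (1 : ℝ)) (0 : E3 →L[ℝ] ℝ) y := hasFDerivAt_const _ _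
    rw [tr_fderiv_radial hu hrad hy, tr_fderiv_cutoff_mul_smul hc hD,
      fderiv_cutoff_mul_smul hc hD, trSq_smul_add_smulRight, hdiv y hy]
    have hi := inner_fderiv_radial hu hyu hy (u y)
    rw [real_inner_comm, real_inner_self_eq_norm_sq] at hi
    simp [hi, real_inner_comm (u y) y, hyu y hy]
    ring
  have hy0 : y ≠ 0 := by rintro rfl; simp at hy
  have h := trSq_fderiv_add_eq_zero (contDiff_cutoff_mul_smul h1 hu)
    hasCompactSupport_cutoff_mul_smul (contDiff_cutoff_mul_smul h2 h3)
    hasCompactSupport_cutoff_mul_smul (fun z => ?_) y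
  · rw [key y hy0, cutoff_eq_one hy, hy] at h
    have := trSq_fderiv_nonneg hu hyu hrad hsym hy0
    have h5 : ‖u y‖ ^ 2 = 0 := le_antisymm (by linarith) (sq_nonneg _)
    simpa using h5
  · by_cases hz : z = 0
    · subst hz
      simp only [fderiv_cutoff_mul_smul_zero]
      simp [tr, trSq]
    · rw [key z hz]
      have := trSq_fderiv_nonneg hu hyu hrad hsym hz
      positivity

/-- Liouville theorem for `0`-homogeneous extensions of solutions with exponent `1`. -/
theorem homogeneous_rigidity {F P : E3 → ℝ} (hu : ∀ y ≠ 0, ContDiffAt ℝ 1 u y)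
    (hF : ∀ y ≠ 0, ContDiffAt ℝ 1 F y) (hP : ∀ y ≠ 0, ContDiffAt ℝ 1 P y)
    (hu0 : ∀ c : ℝ, 0 < c → ∀ y, u (c • y) = u y) (hF0 : ∀ c : ℝ, 0 < c → ∀ y, F (c • y) = F y)
    (hP0 : ∀ c : ℝ, 0 < c → ∀ y, P (c • y) = P y)
    (hyu : ∀ y ≠ 0, ⟪u y, y⟫ = 0) (hrad : ∀ y ≠ 0, fderiv ℝ u y y = 0)
    (e1 : ∀ y ≠ 0, F y + ‖y‖ * tr (fderiv ℝ u y) = 0)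
    (e2 : ∀ y ≠ 0, ‖y‖ * fderiv ℝ F y (u y) = ‖u y‖ ^ 2 + F y ^ 2 + 2 * P y)
    (e3 : ∀ y ≠ 0, ∀ h, ⟪fderiv ℝ u y (u y), h⟫ + (‖y‖ ^ 2)⁻¹ * ‖u y‖ ^ 2 * ⟪y, h⟫ =
      -fderiv ℝ P y h) {y : E3} (hy : ‖y‖ = 1) : u y = 0 ∧ F y = 0 ∧ P y = 0 := by
  have hn : ∀ y : E3, y ≠ 0 → 0 < ‖y‖ := fun y hy => norm_pos_iff.2 hy
  have hs : ∀ y : E3, y ≠ 0 → ‖‖y‖⁻¹ • y‖ = 1 := fun y hy => by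
    rw [norm_smul, norm_inv, norm_norm, inv_mul_cancel₀ (hn y hy).ne']
  have hu1 : ∀ y : E3, y ≠ 0 → u (‖y‖⁻¹ • y) = u y := fun y hy => hu0 _ (inv_pos.2 (hn y hy)) y
  have hF1 : ∀ y : E3, y ≠ 0 → F (‖y‖⁻¹ • y) = F y := fun y hy => hF0 _ (inv_pos.2 (hn y hy)) y
  have hP1 : ∀ y : E3, y ≠ 0 → P (‖y‖⁻¹ • y) = P y := fun y hy => hP0 _ (inv_pos.2 (hn y hy)) y
  have hB : ∀ y ≠ 0, HasFDerivAt (fun z => ‖u z‖ ^ 2 + 2 * P z) _ y := fun y hy =>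
    (hasFDerivAt_of_contDiffAt (hu y hy)).norm_sq.add
      ((hasFDerivAt_of_contDiffAt (hP y hy)).const_mul 2)
  have htr : ∀ y ≠ 0, tr (fderiv ℝ u y) = -F y * ‖y‖⁻¹ := by
    intro y hy
    rw [eq_mul_inv_iff_mul_eq₀ (hn y hy).ne']
    linarith [e1 y hy]
  have hdF : ∀ y ≠ 0, fderiv ℝ F y (u y) = (‖u y‖ ^ 2 + 2 * P y + F y ^ 2) * ‖y‖⁻¹ := by
    intro y hy
    rw [eq_mul_inv_iff_mul_eq₀ (hn y hy).ne']
    linarith [e2 y hy]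
  -- By `e3` with `h = u y`, the Bernoulli function `|u|² + 2P` is constant along `u`, so only `F`
  -- is differentiated.
  have bernoulli : ∀ y ≠ 0,
      (‖u y‖ ^ 2 + 2 * P y) * F y * tr (fderiv ℝ u y) +
        fderiv ℝ (fun z => (‖u z‖ ^ 2 + 2 * P z) * F z) y (u y) =
      (‖u y‖ ^ 2 + 2 * P y) ^ 2 * ‖y‖⁻¹ := by
    intro y hy
    have e3' := e3 y hy (u y)
    rw [real_inner_comm (u y) y, hyu y hy, real_inner_comm, mul_zero, add_zero] at e3'
    have hd : fderiv ℝ (fun z => (‖u z‖ ^ 2 + 2 * P z) * F z) y (u y) =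
        (‖u y‖ ^ 2 + 2 * P y) * fderiv ℝ F y (u y) := by
      refine (congrArg (fun L => L (u y))
        ((hB y hy).mul (hasFDerivAt_of_contDiffAt (hF y hy))).fderiv).trans ?_
      simp [e3']
    rw [hd, htr y hy, hdF y hy]
    ring
  have hB0 : ∀ y ≠ 0, ‖u y‖ ^ 2 + 2 * P y = 0 := by
    intro y hy
    have h := div_eq_zero_of_nonneg (g := fun z => (‖u z‖ ^ 2 + 2 * P z) * F z)
      (fun y hy => (((hu y hy).norm_sq ℝ).add (contDiffAt_const.mul (hP y hy))).mul (hF y hy))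
      hu hyu (fun y hy => by rw [bernoulli y hy]; positivity) (hs y hy)
    rw [bernoulli _ (by simpa using hy), hs y hy, hu1 y hy, hP1 y hy] at h
    simpa using h
  -- With the Bernoulli function zero, `div(F^k u) = (k - 1) F^(k+1) / |y|`; `k = 3` makes this
  -- nonnegative and definite in `F`.
  have cubic : ∀ y ≠ 0, F y ^ 3 * tr (fderiv ℝ u y) + fderiv ℝ (fun z => F z ^ 3) y (u y) =
      2 * F y ^ 4 * ‖y‖⁻¹ := by
    intro y hy
    have hd : fderiv ℝ (fun z => F z ^ 3) y (u y) = 3 * F y ^ 2 * fderiv ℝ F y (u y) := by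
      refine (congrArg (fun L => L (u y))
        ((hasFDerivAt_of_contDiffAt (hF y hy)).pow 3).fderiv).trans ?_
      simp
    rw [hd, htr y hy, hdF y hy, hB0 y hy]
    ring
  have hF00 : ∀ y ≠ 0, F y = 0 := by
    intro y hy
    have h := div_eq_zero_of_nonneg (g := fun z => F z ^ 3) (fun y hy => (hF y hy).pow 3)
      hu hyu (fun y hy => by rw [cubic y hy]; positivity) (hs y hy)
    rw [cubic _ (by simpa using hy), hs y hy, hF1 y hy] at h
    simpa using h
  have hy0 : y ≠ 0 := by rintro rfl; simp at hy
  have hu00 : u y = 0 := by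
    refine eq_zero_of_tangentDeriv_symm hu hyu hrad (fun y hy => ?_) (fun y hy h => ?_) hy
    · rw [htr y hy, hF00 y hy, neg_zero, zero_mul]
    · rw [e3 y hy h]
      -- Differentiating `|u|² + 2P = 0` turns `-∇P` into `½∇|u|²`.
      have h2 : (fun z => ‖u z‖ ^ 2 + 2 * P z) =ᶠ[𝓝 y] fun _ => 0 := by
        filter_upwards [isOpen_ne.mem_nhds hy] with z hz using hB0 z hz
      have h3 := congrArg (fun L => L h)
        ((hB y hy).unique ((hasFDerivAt_const 0 y).congr_of_eventuallyEq h2))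
      simp [real_inner_comm (fderiv ℝ u y h) (u y)] at h3
      linarith
  have := hB0 y hy0
  exact ⟨hu00, hF00 y hy0, by simpa [hu00] using this⟩

end

/-! ### From the sphere to homogeneous extensions -/

section

/-- The radial projection of a nonzero vector to the sphere. -/
def toSphere (y : E3) (hy : y ≠ 0) : S2 := ⟨‖y‖⁻¹ • y, normalize_mem y hy⟩

theorem norm_smul_toSphere {y : E3} (hy : y ≠ 0) : ‖y‖ • (toSphere y hy : E3) = y := by
  simp [toSphere, smul_smul, hy]

theorem homExt_of_ne {F : Type*} [Zero F] {g : S2 → F} {y : E3} (hy : y ≠ 0) : homExt g y = g (toSphere y hy) := by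
  simp [homExt, hy, toSphere]

theorem sphere_ne_zero (x : S2) : (x : E3) ≠ 0 := ne_zero_of_mem_unit_sphere x

theorem homExt_smul {F : Type*} [Zero F] (g : S2 → F) {c : ℝ} (hc : 0 < c) (y : E3) :
    homExt g (c • y) = homExt g y := by
  by_cases hy : y = 0
  · simp [hy]
  · have hcy : c • y ≠ 0 := smul_ne_zero hc.ne' hy
    rw [homExt_of_ne hy, homExt_of_ne hcy]
    congr 1
    ext1
    simp only [toSphere, norm_smul, Real.norm_eq_abs, abs_of_pos hc, smul_smul, mul_inv]
    congr 1
    field_simp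

theorem homExt_coe {F : Type*} [Zero F] (g : S2 → F) (x : S2) : homExt g (x : E3) = g x := by
  rw [homExt_of_ne (sphere_ne_zero x)]
  congr 1
  ext1
  simp [toSphere]

section Homogeneous

variable {F : Type*} [NormedAddCommGroup F] [NormedSpace ℝ F]

theorem contDiffAt_homExt {g : S2 → F} (hg : ContMDiff (𝓡 2) 𝓘(ℝ, F) 1 g) {y : E3} (hy : y ≠ 0) :
    ContDiffAt ℝ 1 (homExt g) y := by
  let O : TopologicalSpace.Opens E3 := ⟨{0}ᶜ, isOpen_compl_singleton⟩
  have h1 : ContMDiff 𝓘(ℝ, E3) 𝓘(ℝ, E3) 1 fun z : O => ‖(z : E3)‖⁻¹ • (z : E3) := by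
    intro z
    refine (contMDiffAt_subtype_iff (f := fun z : E3 => ‖z‖⁻¹ • z)).2 ?_
    have hz : (z : E3) ≠ 0 := z.2
    exact (((contDiffAt_norm ℝ hz).inv (norm_ne_zero_iff.2 hz)).smul contDiffAt_id).contMDiffAt
  have h2 := h1.codRestrict_sphere (n := 2) (fun z => normalize_mem z z.2)
  have h3 : ContMDiff 𝓘(ℝ, E3) 𝓘(ℝ, F) 1 fun z : O => homExt g z := by
    refine (hg.comp h2).congr fun z => ?_
    exact homExt_of_ne z.2
  exact (contMDiffAt_subtype_iff.1 (h3 ⟨y, hy⟩)).contDiffAt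

variable {f : E3 → F}

theorem fderiv_smul_of_homogeneous (hf : ∀ c : ℝ, 0 < c → ∀ y, f (c • y) = f y) {c : ℝ}
    (hc : 0 < c) {y : E3} (hd : DifferentiableAt ℝ f (c • y)) :
    fderiv ℝ f y = c • fderiv ℝ f (c • y) := by
  have h1 : HasFDerivAt (fun z : E3 => c • z) (c • ContinuousLinearMap.id ℝ E3) y :=
    (hasFDerivAt_id y).const_smul c
  have h2 := hd.hasFDerivAt.comp y h1
  have h3 : f ∘ (fun z : E3 => c • z) = f := funext fun z => hf c hc z
  rw [h3] at h2
  rw [h2.fderiv]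
  ext h
  simp

theorem fderiv_self_of_homogeneous (hf : ∀ c : ℝ, 0 < c → ∀ y, f (c • y) = f y) {y : E3}
    (hd : DifferentiableAt ℝ f y) : fderiv ℝ f y y = 0 := by
  have h1 : HasDerivAt (fun t : ℝ => t • y) y 1 := by
    simpa using (hasDerivAt_id (1 : ℝ)).smul_const y
  have h0 : HasFDerivAt f (fderiv ℝ f y) ((1 : ℝ) • y) := by simpa using hd.hasFDerivAt
  have h2 := h0.comp_hasDerivAt (1 : ℝ) h1
  have h3 : (f ∘ fun t : ℝ => t • y) =ᶠ[𝓝 1] fun _ => f y := by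
    filter_upwards [lt_mem_nhds one_pos] with t ht using hf t ht y
  exact h2.unique ((hasDerivAt_const 1 (f y)).congr_of_eventuallyEq h3)

end Homogeneous

theorem tangentProj_apply (x : S2) (z : E3) : tangentProj x z = z - ⟪(x : E3), z⟫ • (x : E3) := by
  rw [tangentProj, Submodule.starProjection_orthogonal']
  simp [Submodule.starProjection_unit_singleton ℝ (norm_eq_of_mem_sphere x)]

theorem covDeriv_apply (v : S2 → E3) (x : S2) (z : E3) :
    covDeriv v x z = fderiv ℝ (homExt v) x z -
      ⟪(x : E3), fderiv ℝ (homExt v) x z⟫ • (x : E3) := by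
  rw [covDeriv, ContinuousLinearMap.comp_apply, tangentProj_apply]

theorem trace_eq_tr (L : E3 →L[ℝ] E3) : LinearMap.trace ℝ E3 (L : E3 →ₗ[ℝ] E3) = tr L := by
  rw [LinearMap.trace_eq_sum_inner _ (EuclideanSpace.basisFun (Fin 3) ℝ)]
  refine Finset.sum_congr rfl fun i _ => ?_
  rw [real_inner_comm, EuclideanSpace.basisFun_apply]
  exact inner_e _ i

/-- The tangential projection changes the derivative by a rank-one map of trace `-⟪x, D x⟫`, which
vanishes because the extension is constant along rays. -/
theorem sphereDiv_eq {v : S2 → E3} {x : S2} (h : DifferentiableAt ℝ (homExt v) x) :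
    sphereDiv v x = tr (fderiv ℝ (homExt v) x) := by
  have h1 : covDeriv v x = fderiv ℝ (homExt v) x +
      (-(innerSL ℝ (x : E3) ∘L fderiv ℝ (homExt v) x)).smulRight (x : E3) := by
    ext1 z
    simp [covDeriv_apply, sub_eq_add_neg]
  rw [sphereDiv, trace_eq_tr, h1, tr_add, tr_smulRight]
  simp [fderiv_self_of_homogeneous (fun c hc y => homExt_smul v hc y) h]

theorem inner_sphereGrad (f : S2 → ℝ) (x : S2) (h : E3) :
    ⟪sphereGrad f x, h⟫ = fderiv ℝ (homExt f) x h := by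
  rw [sphereGrad, gradient, InnerProductSpace.toDual_symm_apply]

theorem IsC1Solution.eq_zero {v : S2 → E3} {f p : S2 → ℝ} (hs : IsC1Solution 1 v f p) (x : S2) :
    v x = 0 ∧ f x = 0 ∧ p x = 0 := by
  have hv := fun y hy => contDiffAt_homExt hs.contMDiff_v (y := y) hy
  have hf := fun y hy => contDiffAt_homExt hs.contMDiff_f (y := y) hy
  have hp := fun y hy => contDiffAt_homExt hs.contMDiff_p (y := y) hy
  have dv := fun y hy => (hv y hy).differentiableAt one_ne_zero
  have hv0 := fun (c : ℝ) (hc : 0 < c) y => homExt_smul v hc y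
  have hf0 := fun (c : ℝ) (hc : 0 < c) y => homExt_smul f hc y
  have hp0 := fun (c : ℝ) (hc : 0 < c) y => homExt_smul p hc y
  have hyu : ∀ y ≠ 0, ⟪homExt v y, y⟫ = 0 := by
    intro y hy
    have h := hs.tangent (toSphere y hy)
    rw [← homExt_of_ne (g := v) hy] at h
    have h2 : ⟪homExt v y, ‖y‖ • (toSphere y hy : E3)⟫ = 0 := by
      rw [real_inner_smul_right, h, mul_zero]
    rwa [norm_smul_toSphere hy] at h2
  -- Derivatives of `0`-homogeneous maps are homogeneous of degree `-1`; this produces the powers of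
  -- `‖y‖` in the hypotheses of `homogeneous_rigidity`.
  have scale : ∀ {F : Type} [NormedAddCommGroup F] [NormedSpace ℝ F] (g : S2 → F),
      (∀ y ≠ 0, ContDiffAt ℝ 1 (homExt g) y) → ∀ (y : E3) (hy : y ≠ 0),
      fderiv ℝ (homExt g) (toSphere y hy) = ‖y‖ • fderiv ℝ (homExt g) y := by
    intro F _ _ g hg y hy
    have h := fderiv_smul_of_homogeneous (f := homExt g) (fun c hc y => homExt_smul g hc y)
      (norm_pos_iff.2 hy) (y := toSphere y hy)
      (by rw [norm_smul_toSphere hy]; exact (hg y hy).differentiableAt one_ne_zero)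
    rwa [norm_smul_toSphere hy] at h
  have key := homogeneous_rigidity hv hf hp hv0 hf0 hp0 hyu
    (fun y hy => fderiv_self_of_homogeneous hv0 (dv y hy))
    (fun y hy => ?_) (fun y hy => ?_) (fun y hy h => ?_) (norm_eq_of_mem_sphere x)
  · simpa only [homExt_coe] using key
  · have h := hs.incompressible (toSphere y hy)
    rw [sphereDiv_eq (dv _ (sphere_ne_zero _)), scale v hv y hy, tr_smul] at h
    rw [homExt_of_ne hy]
    linarith
  · have h := hs.radial (toSphere y hy)
    rw [real_inner_comm, inner_sphereGrad, scale f hf y hy] at h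
    simp only [homExt_of_ne hy]
    simpa using h
  · have h1 := hs.tangential (toSphere y hy)
    have hn := norm_ne_zero_iff.2 hy
    -- The normal component of `D_v v` is determined by `|v|²`, so the projected equation becomes an
    -- identity for the ambient derivative.
    have h2 := inner_fderiv_radial hv hyu hy (homExt v y)
    rw [real_inner_comm, real_inner_self_eq_norm_sq] at h2
    rw [sub_self, zero_mul, zero_smul, zero_add, covDeriv_apply, scale v hv y hy,
      ← homExt_of_ne (g := v) hy] at h1
    have h3 := congrArg (fun z => ⟪z, h⟫) h1
    have h4 : (toSphere y hy : E3) = ‖y‖⁻¹ • y := rfl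
    simp only [inner_neg_left, inner_sphereGrad, scale p hp y hy] at h3
    simp only [inner_sub_left, smul_apply, real_inner_smul_left, real_inner_smul_right, h4, h2,
      smul_eq_mul] at h3
    field_simp at h3 ⊢
    linarith

theorem isC1Solution_zero {v : S2 → E3} {f p : S2 → ℝ} (hv : ∀ x, v x = 0) (hf : ∀ x, f x = 0)
    (hp : ∀ x, p x = 0) : IsC1Solution 1 v f p := by
  obtain rfl : v = fun _ => 0 := funext hv
  obtain rfl : f = fun _ => 0 := funext hf
  obtain rfl : p = fun _ => 0 := funext hp
  have h0 : homExt (fun _ : S2 => (0 : ℝ)) = fun _ => 0 := by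
    funext y
    simp [homExt]
  exact
    { tangent := by simp
      contMDiff_v := contMDiff_const
      contMDiff_f := contMDiff_const
      contMDiff_p := contMDiff_const
      incompressible := fun x => by
        have h1 : homExt (fun _ : S2 => (0 : E3)) = fun _ => 0 := by
          funext y
          simp [homExt]
        simp [sphereDiv, covDeriv, h1]
      radial := by simp
      tangential := fun x => by simp [sphereGrad, h0, gradient] }

end

end SphereEuler

end

theorem proposition2p1 (v : SphereEuler.S2 → SphereEuler.E3) (f p : SphereEuler.S2 → ℝ) :
    SphereEuler.IsC1Solution 1 v f p ↔
      (∀ x, v x = 0) ∧ (∀ x, f x = 0) ∧ (∀ x, p x = 0) :=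
  ⟨fun h => ⟨fun x => (h.eq_zero x).1, fun x => (h.eq_zero x).2.1, fun x => (h.eq_zero x).2.2⟩,
    fun h => SphereEuler.isC1Solution_zero h.1 h.2.1 h.2.2⟩
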